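/- Let $n,m\ge 0$ and $N=n+m$. Let $p(a)=0$ for $1\le a\le n$ and $p(a)=1$ for $n<a\le N$, let $e_1,\dots,e_N$ be the standard basis of $\mathbb{C}^{n|m}$ (with $e_a$ of parity $p(a)$), and let $V=(\mathbb{C}^{n|m})^{\otimes N}$. For $1\le i\le N$ let $e^{(i)}_{ab}$ be the matrix unit $e_{ab}$ (of parity $p(a)+p(b)$) acting in the $i$-th tensor factor according to the sign rule for graded tensor products, that is, $$e^{(i)}_{ab}(e_{w_1}\otimes\cdots\otimes e_{w_N})=\delta_{b,w_i}(-1)^{(p(a)+p(b))(p(w_1)+\cdots+p(w_{i-1}))}\,e_{w_1}\otimes\cdots\otimes e_{w_{i-1}}\otimes e_a\otimes e_{w_{i+1}}\otimes\cdots\otimes e_{w_N}.$$ Put $E_{ab}=\sum_{j=1}^N e^{(j)}_{ab}$ and, for $i\ne j$, let $P_{ij}=\sum_{a,b}(-1)^{p(b)}e^{(i)}_{ab}e^{(j)}_{ba}$ be the graded permutation of the $i$-th and $j$-th factors. For $\sigma\in S_N$ let $P_\sigma$ be the corresponding graded permutation operator, that is, the product $P_{s_1}\cdots P_{s_l}$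 for any decomposition $\sigma=s_1\cdots s_l$ into transpositions, where $P_s=P_{ij}$ for $s=(i\,j)$. Let $V[1]\subset V$ be the subspace of all $v$ with $E_{aa}v=v$ for all $a$. For $i=0,1$ define the covector $$\langle\Omega^i|=\sum_{\sigma\in S_N}\operatorname{sgn}(\sigma)^i\,\langle e_1\otimes\cdots\otimes e_N|\,P_\sigma ,$$ where $\langle e_1\otimes\cdots\otimes e_N|$ takes the coefficient of $e_1\otimes\cdots\otimes e_N$. Let $\kappa\in\mathbb{C}$, let $U$ be an open set of points $(z,\lambda)\in\mathbb{C}^N\times\mathbb{C}^N$ with pairwise distinct $z_1,\dots,z_N$ and pairwise distinct $\lambda_1,\dots,\lambda_N$, and let $|\Psi\rangle\colon U\to V[1]$ be a holomorphic solution of the joint system $$\Bigl(\kappa\,\partial_{z_i}-\sum_{c}\lambda_c e^{(i)}_{cc}-\sum_{j\ne i}\frac{P_{ij}}{z_i-z_j}\Bigr)|\Psi\rangle=0\qquad(1\le i\le N),$$ $$\Bigl(\kappa\,\partial_{\lambda_a}-\sum_{j}z_j e^{(j)}_{aa}-\sum_{b\ne a}(-1)^{p(b)}\frac{E_{ab}E_{ba}-E_{aa}}{\lambda_a-\lambda_b}\Bigr)|\Psi\rangle=0\qquad(1\le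 a\le N).$$ Then for $i=0$ and $i=1$ one has on $U$ $$\Bigl(\kappa^2\sum_{a=1}^{N}\frac{\partial^2}{\partial z_a^2}+\sum_{a\ne b}\frac{(-1)^i\kappa-1}{(z_a-z_b)^2}\Bigr)\langle\Omega^i|\Psi\rangle=\Bigl(\sum_{a=1}^{N}\lambda_a^2\Bigr)\langle\Omega^i|\Psi\rangle,$$ $$\Bigl(\kappa^2\sum_{a=1}^{N}\frac{\partial^2}{\partial\lambda_a^2}+\sum_{a\ne b}\frac{(-1)^i\kappa-1}{(\lambda_a-\lambda_b)^2}\Bigr)\langle\Omega^i|\Psi\rangle=\Bigl(\sum_{a=1}^{N}z_a^2\Bigr)\langle\Omega^i|\Psi\rangle,$$ where the sums over $a\ne b$ run over ordered pairs. -/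

import Mathlib

open scoped BigOperators

namespace SuperKZ

noncomputable section

/-- The parity of the index `a`: the first `n` indices are even, the last `m` are odd. -/
def parity (n m : ℕ) (a : Fin (n + m)) : ℕ := if (a : ℕ) < n then 0 else 1

/-- The `k`-fold tensor power of `ℂ^{n|m}`, in coordinates with respect to the basis
`e_{w 1} ⊗ ⋯ ⊗ e_{w k}` indexed by the words `w`. -/
abbrev TensorSpace (n m k : ℕ) : Type := (Fin k → Fin (n + m)) → ℂ

/-- The basis vector `e_{w 1} ⊗ ⋯ ⊗ e_{w k}`. -/
def basisVec (n m k : ℕ) (w : Fin k → Fin (n + m)) : TensorSpace n m k := Pi.single w 1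

/-- The operator `e_{ab}^{(i)}`: the matrix unit `e_{ab}` acting in the `i`-th tensor factor of the
tensor power, with the sign rule for graded tensor products (see `unitAt_basisVec`). -/
def unitAt (n m k : ℕ) (i : Fin k) (a b : Fin (n + m)) : Module.End ℂ (TensorSpace n m k) where
  toFun v u :=
    if u i = a then
      (-1 : ℂ) ^ ((parity n m a + parity n m b) * ∑ l ∈ Finset.Iio i, parity n m (u l)) *
        v (Function.update u i b)
    else 0
  map_add' v v' := by
    funext u
    by_cases h : u i = a <;> simp [h, mul_add]
  map_smul' c v := by
    funext u
    by_cases h : u i = a <;> simp [h, mul_left_comm]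

/-- `e_{ab}^{(i)}` sends `e_{w 1} ⊗ ⋯ ⊗ e_{w k}` to zero if `w i ≠ b`, and otherwise replaces the
`i`-th factor `e_b` by `e_a`, with the sign `(-1)^{p(e_{ab}) (p(w 1) + ⋯ + p(w (i-1)))}`. -/
theorem unitAt_basisVec (n m k : ℕ) (i : Fin k) (a b : Fin (n + m)) (w : Fin k → Fin (n + m)) :
    unitAt n m k i a b (basisVec n m k w) =
      if w i = b then
        (-1 : ℂ) ^ ((parity n m a + parity n m b) * ∑ l ∈ Finset.Iio i, parity n m (w l)) •
          basisVec n m k (Function.update w i a)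
      else 0 := by
  funext u
  have key : (u i = a ∧ Function.update u i b = w) ↔ (w i = b ∧ u = Function.update w i a) := by
    constructor
    · rintro ⟨rfl, rfl⟩
      simp
    · rintro ⟨rfl, rfl⟩
      simp
  by_cases h1 : u i = a ∧ Function.update u i b = w
  · have h2 := key.1 h1
    have hs : ∑ l ∈ Finset.Iio i, parity n m (u l) = ∑ l ∈ Finset.Iio i, parity n m (w l) := by
      refine Finset.sum_congr rfl fun l hl => ?_
      rw [h2.2, Function.update_of_ne (Finset.mem_Iio.1 hl).ne]
    simp only [unitAt, LinearMap.coe_mk, AddHom.coe_mk, basisVec, if_pos h1.1, if_pos h2.1, hs,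
      Pi.smul_apply, smul_eq_mul, h1.2, ← h2.2, Pi.single_eq_same]
  · have h2 := mt key.2 h1
    have hl : unitAt n m k i a b (basisVec n m k w) u = 0 := by
      by_cases h : u i = a
      · have : Function.update u i b ≠ w := fun h' => h1 ⟨h, h'⟩
        simp [unitAt, basisVec, h, this]
      · simp [unitAt, h]
    rw [hl]
    by_cases h : w i = b
    · have : u ≠ Function.update w i a := fun h' => h2 ⟨h, h'⟩
      simp [basisVec, h, this]
    · simp [h]

/-- The total generator `E_{ab} = ∑_j e_{ab}^{(j)}`. -/
def total (n m k : ℕ) (a b : Fin (n + m)) : Module.End ℂ (TensorSpace n m k) :=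
  ∑ j, unitAt n m k j a b

/-- The graded permutation of two tensor factors, `P_{ij} = ∑_{a,b} (-1)^{p(b)} e_{ab}^{(i)}
e_{ba}^{(j)}` (used for `i ≠ j` only). -/
def gradedSwap (n m k : ℕ) (i j : Fin k) : Module.End ℂ (TensorSpace n m k) :=
  ∑ a, ∑ b, (-1 : ℂ) ^ parity n m b • (unitAt n m k i a b * unitAt n m k j b a)

/-- The sign of the graded permutation `σ` on `e_{w 1} ⊗ ⋯ ⊗ e_{w k}`: a factor
`(-1)^{p(w i) p(w j)}` for each pair of tensor factors whose order is reversed. -/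
def koszulSign (n m k : ℕ) (σ : Equiv.Perm (Fin k)) (w : Fin k → Fin (n + m)) : ℂ :=
  ∏ x : Fin k × Fin k with x.1 < x.2 ∧ σ x.2 < σ x.1,
    (-1 : ℂ) ^ (parity n m (w x.1) * parity n m (w x.2))

/-- The operator `P_σ` of the graded permutation of the tensor factors (see
`gradedPerm_basisVec` and `gradedPerm_list_prod`). -/
def gradedPerm (n m k : ℕ) (σ : Equiv.Perm (Fin k)) : Module.End ℂ (TensorSpace n m k) where
  toFun v u := koszulSign n m k σ (u ∘ σ) * v (u ∘ σ)
  map_add' v v' := by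
    funext u
    simp [mul_add]
  map_smul' c v := by
    funext u
    simp [mul_left_comm]

/-- `P_σ` moves the `i`-th tensor factor to the place `σ i`, with the graded sign. -/
theorem gradedPerm_basisVec (n m k : ℕ) (σ : Equiv.Perm (Fin k)) (w : Fin k → Fin (n + m)) :
    gradedPerm n m k σ (basisVec n m k w) =
      koszulSign n m k σ w • basisVec n m k (w ∘ σ.symm) := by
  funext u
  have key : u ∘ σ = w ↔ u = w ∘ σ.symm := by
    constructor
    · rintro rfl
      funext x
      simp
    · rintro rfl
      funext x
      simp
  by_cases h : u ∘ σ = w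
  · have h' := key.1 h
    simp only [gradedPerm, LinearMap.coe_mk, AddHom.coe_mk, basisVec, h, Pi.smul_apply,
      smul_eq_mul, ← h', Pi.single_eq_same]
  · have h' := mt key.2 h
    simp [gradedPerm, basisVec, h, h']

theorem prod_pairs_comp (k : ℕ) (τ : Equiv.Perm (Fin k)) (h : Fin k → Fin k → ℂ)
    (hs : ∀ i j, h i j = h j i) :
    ∏ x : Fin k × Fin k with x.1 < x.2, h (τ x.1) (τ x.2) =
      ∏ x : Fin k × Fin k with x.1 < x.2, h x.1 x.2 := by
  refine Finset.prod_bij'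
    (fun x _ => if τ x.1 < τ x.2 then (τ x.1, τ x.2) else (τ x.2, τ x.1))
    (fun x _ => if τ.symm x.1 < τ.symm x.2 then (τ.symm x.1, τ.symm x.2)
      else (τ.symm x.2, τ.symm x.1)) ?_ ?_ ?_ ?_ ?_
  · rintro ⟨i, j⟩ hx
    simp only [Finset.mem_filter, Finset.mem_univ, true_and] at hx ⊢
    split_ifs with h1
    · exact h1
    · exact lt_of_le_of_ne (not_lt.1 h1) fun e => hx.ne' (τ.injective e)
  · rintro ⟨i, j⟩ hx
    simp only [Finset.mem_filter, Finset.mem_univ, true_and] at hx ⊢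
    split_ifs with h1
    · exact h1
    · exact lt_of_le_of_ne (not_lt.1 h1) fun e => hx.ne' (τ.symm.injective e)
  · rintro ⟨i, j⟩ hx
    simp only [Finset.mem_filter, Finset.mem_univ, true_and] at hx
    by_cases h1 : τ i < τ j <;> simp [h1, hx, hx.not_gt]
  · rintro ⟨i, j⟩ hx
    simp only [Finset.mem_filter, Finset.mem_univ, true_and] at hx
    by_cases h1 : τ.symm i < τ.symm j <;> simp [h1, hx, hx.not_gt]
  · rintro ⟨i, j⟩ hx
    by_cases h1 : τ i < τ j
    · simp [h1]
    · simpa [h1] using hs _ _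

theorem koszulSign_mul (n m k : ℕ) (σ τ : Equiv.Perm (Fin k)) (w : Fin k → Fin (n + m)) :
    koszulSign n m k (σ * τ) w = koszulSign n m k σ (w ∘ τ.symm) * koszulSign n m k τ w := by
  have aux : ∀ (ρ : Equiv.Perm (Fin k)) (w : Fin k → Fin (n + m)), koszulSign n m k ρ w =
      ∏ x : Fin k × Fin k with x.1 < x.2, (fun i j =>
        if (i < j ↔ ρ j < ρ i) then (-1 : ℂ) ^ (parity n m (w i) * parity n m (w j)) else 1)
          x.1 x.2 := by
    intro ρ w
    rw [koszulSign, Finset.prod_ite, Finset.prod_const_one, mul_one, Finset.filter_filter]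
    refine Finset.prod_congr ?_ fun _ _ => rfl
    ext ⟨i, j⟩
    simp only [Finset.mem_filter, Finset.mem_univ, true_and]
    tauto
  rw [aux (σ * τ), aux σ, aux τ, ← prod_pairs_comp k τ (fun i j =>
    if (i < j ↔ σ j < σ i) then
      (-1 : ℂ) ^ (parity n m ((w ∘ τ.symm) i) * parity n m ((w ∘ τ.symm) j)) else 1),
    ← Finset.prod_mul_distrib]
  · refine Finset.prod_congr rfl fun x hx => ?_
    obtain ⟨i, j⟩ := x
    simp only [Finset.mem_filter, Finset.mem_univ, true_and] at hx
    have h1 : ∀ ρ : Equiv.Perm (Fin k), ρ i ≠ ρ j := fun ρ e => hx.ne (ρ.injective e)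
    have h2 := h1 τ
    have h3 := h1 (σ * τ)
    have sq : ∀ e : ℕ, (-1 : ℂ) ^ e * (-1 : ℂ) ^ e = 1 := fun e => by
      rw [← mul_pow]; simp
    simp only [Equiv.Perm.coe_mul, Function.comp_apply, Equiv.symm_apply_apply] at h3 ⊢
    rcases lt_or_gt_of_ne h2 with h2 | h2 <;> rcases lt_or_gt_of_ne h3 with h3 | h3 <;>
      simp [hx, h2, h3, h2.not_gt, h3.not_gt, sq]
  · intro i j
    by_cases e : i = j
    · rw [e]
    · have e' : σ i ≠ σ j := fun h => e (σ.injective h)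
      have : (i < j ↔ σ j < σ i) ↔ (j < i ↔ σ i < σ j) := by
        rcases lt_or_gt_of_ne e with h | h <;> rcases lt_or_gt_of_ne e' with h' | h' <;>
          simp [h, h', h.not_gt, h'.not_gt]
      simp only [this, mul_comm]

theorem gradedPerm_one (n m k : ℕ) : gradedPerm n m k 1 = 1 := by
  refine LinearMap.ext fun v => funext fun u => ?_
  have : koszulSign n m k 1 u = 1 := by
    refine Finset.prod_eq_one fun x hx => ?_
    rw [Finset.mem_filter] at hx
    exact absurd hx.2.1 (not_lt_of_gt hx.2.2)
  simp [gradedPerm, this]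

theorem gradedPerm_mul (n m k : ℕ) (σ τ : Equiv.Perm (Fin k)) :
    gradedPerm n m k (σ * τ) = gradedPerm n m k σ * gradedPerm n m k τ := by
  refine LinearMap.ext fun v => funext fun u => ?_
  have e : (u ∘ (σ * τ : Equiv.Perm (Fin k))) ∘ τ.symm = u ∘ σ := by
    funext x
    simp
  simp only [gradedPerm, LinearMap.coe_mk, AddHom.coe_mk, Module.End.mul_apply, koszulSign_mul, e]
  rw [mul_assoc]
  rfl

theorem koszulSign_swap (n m k : ℕ) (i j : Fin k) (hij : i < j) (w : Fin k → Fin (n + m)) :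
    koszulSign n m k (Equiv.swap i j) w =
      (-1 : ℂ) ^ (parity n m (w i) * parity n m (w j) +
        (parity n m (w i) + parity n m (w j)) * ∑ l ∈ Finset.Ioo i j, parity n m (w l)) := by
  have hset : (Finset.univ.filter fun x : Fin k × Fin k =>
      x.1 < x.2 ∧ Equiv.swap i j x.2 < Equiv.swap i j x.1) =
      insert (i, j) ((Finset.Ioo i j).image (fun l => (i, l)) ∪
        (Finset.Ioo i j).image (fun l => (l, j))) := by
    ext ⟨x, y⟩
    rw [Finset.mem_filter]
    simp only [Finset.mem_univ, true_and, Finset.mem_insert, Finset.mem_union, Finset.mem_image,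
      Finset.mem_Ioo, Prod.mk.injEq, Equiv.swap_apply_def]
    constructor
    · rintro ⟨h1, h2⟩
      by_cases hx : x = i
      · subst hx
        by_cases hy : y = j
        · exact Or.inl ⟨rfl, hy⟩
        · refine Or.inr (Or.inl ⟨y, ⟨h1, ?_⟩, rfl, rfl⟩)
          simpa [hy, h1.ne'] using h2
      · by_cases hy : y = j
        · subst hy
          refine Or.inr (Or.inr ⟨x, ⟨?_, h1⟩, rfl, rfl⟩)
          simpa [hx, h1.ne, hij.ne'] using h2
        · exfalso
          split_ifs at h2 <;> omega
    · rintro (⟨rfl, rfl⟩ | ⟨l, ⟨h1, h2⟩, rfl, rfl⟩ | ⟨l, ⟨h1, h2⟩, rfl, rfl⟩)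
      · simp [hij, hij.ne']
      · simp [h1, h2, h1.ne', h2.ne]
      · simp [h1, h2, h1.ne', h2.ne, hij.ne']
  rw [koszulSign, hset, Finset.prod_insert, Finset.prod_union, Finset.prod_image,
    Finset.prod_image, Finset.prod_pow_eq_pow_sum, Finset.prod_pow_eq_pow_sum, ← pow_add, ← pow_add,
    add_mul, Finset.mul_sum, Finset.mul_sum]
  · simp only [mul_comm]
  · intro a _ b _ h
    exact (Prod.mk.inj h).1
  · intro a _ b _ h
    exact (Prod.mk.inj h).2
  · rw [Finset.disjoint_left]
    rintro ⟨x, y⟩ h1 h2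
    simp only [Finset.mem_image, Finset.mem_Ioo, Prod.mk.injEq] at h1 h2
    obtain ⟨l, hl, rfl, rfl⟩ := h1
    obtain ⟨l', hl', rfl, rfl⟩ := h2
    exact lt_irrefl _ hl'.1
  · simp

theorem sum_Iio_update (n m k : ℕ) (i j : Fin k) (hij : i < j) (u : Fin k → Fin (n + m))
    (b : Fin (n + m)) :
    ∑ l ∈ Finset.Iio j, parity n m (Function.update u i b l) =
      ∑ l ∈ Finset.Iio i, parity n m (u l) +
        (parity n m b + ∑ l ∈ Finset.Ioo i j, parity n m (u l)) := by
  have hset : Finset.Iio j = Finset.Iio i ∪ insert i (Finset.Ioo i j) := by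
    ext x
    simp only [Finset.mem_Iio, Finset.mem_union, Finset.mem_insert, Finset.mem_Ioo]
    omega
  rw [hset, Finset.sum_union, Finset.sum_insert (by simp), Function.update_self]
  · congr 1
    · exact Finset.sum_congr rfl fun l hl => by
        rw [Function.update_of_ne (Finset.mem_Iio.1 hl).ne]
    · congr 1
      exact Finset.sum_congr rfl fun l hl => by
        rw [Function.update_of_ne (Finset.mem_Ioo.1 hl).1.ne']
  · rw [Finset.disjoint_left]
    intro x h1 h2
    simp only [Finset.mem_Iio, Finset.mem_insert, Finset.mem_Ioo] at h1 h2
    omega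

theorem gradedPerm_swap (n m k : ℕ) (i j : Fin k) (hij : i ≠ j) :
    gradedPerm n m k (Equiv.swap i j) = gradedSwap n m k i j := by
  refine LinearMap.ext fun v => funext fun u => ?_
  have hu : u ∘ Equiv.swap i j = Function.update (Function.update u i (u j)) j (u i) := by
    funext x
    by_cases h1 : x = j
    · subst h1
      simp
    · by_cases h2 : x = i
      · subst h2
        simp [h1]
      · simp [h1, h2, Equiv.swap_apply_of_ne_of_ne]
  have hR : gradedSwap n m k i j v u = (-1 : ℂ) ^ parity n m (u j) *
      ((-1 : ℂ) ^ ((parity n m (u i) + parity n m (u j)) *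
          ∑ l ∈ Finset.Iio i, parity n m (u l)) *
        ((-1 : ℂ) ^ ((parity n m (u j) + parity n m (u i)) *
          ∑ l ∈ Finset.Iio j, parity n m (Function.update u i (u j) l)) *
        v (Function.update (Function.update u i (u j)) j (u i)))) := by
    simp only [gradedSwap, LinearMap.sum_apply, Finset.sum_apply, LinearMap.smul_apply,
      Pi.smul_apply, Module.End.mul_apply, unitAt, LinearMap.coe_mk, AddHom.coe_mk, smul_eq_mul,
      Function.update_of_ne hij.symm]
    rw [Finset.sum_eq_single (u i), Finset.sum_eq_single (u j)]
    · simp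
    · intro b _ hb
      simp [hb.symm]
    · simp
    · intro a _ ha
      exact Finset.sum_eq_zero fun b _ => by simp [ha.symm]
    · simp
  have hp : ∀ a : Fin (n + m), parity n m a = 0 ∨ parity n m a = 1 := fun a => by
    unfold parity
    split_ifs <;> simp
  rw [hR, ← hu]
  simp only [gradedPerm, LinearMap.coe_mk, AddHom.coe_mk]
  rw [← mul_assoc, ← mul_assoc, ← pow_add, ← pow_add]
  congr 1
  rcases lt_or_gt_of_ne hij with h | h
  · have hs : ∑ l ∈ Finset.Ioo i j, parity n m ((u ∘ Equiv.swap i j) l) =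
        ∑ l ∈ Finset.Ioo i j, parity n m (u l) := Finset.sum_congr rfl fun l hl => by
      have := Finset.mem_Ioo.1 hl
      rw [Function.comp_apply, Equiv.swap_apply_of_ne_of_ne this.1.ne' this.2.ne]
    rw [koszulSign_swap n m k i j h, hs, sum_Iio_update n m k i j h]
    simp only [Function.comp_apply, Equiv.swap_apply_left, Equiv.swap_apply_right]
    generalize ∑ l ∈ Finset.Ioo i j, parity n m (u l) = M
    generalize ∑ l ∈ Finset.Iio i, parity n m (u l) = S
    rcases hp (u i) with e | e <;> rcases hp (u j) with e' | e' <;> rw [e, e'] <;>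
      refine neg_one_pow_congr ?_ <;> simp only [Nat.even_iff] <;> omega
  · have hs : ∑ l ∈ Finset.Ioo j i, parity n m ((u ∘ Equiv.swap j i) l) =
        ∑ l ∈ Finset.Ioo j i, parity n m (u l) := Finset.sum_congr rfl fun l hl => by
      have := Finset.mem_Ioo.1 hl
      rw [Function.comp_apply, Equiv.swap_apply_of_ne_of_ne this.1.ne' this.2.ne]
    have h1 : ∑ l ∈ Finset.Iio j, parity n m (Function.update u i (u j) l) =
        ∑ l ∈ Finset.Iio j, parity n m (u l) := Finset.sum_congr rfl fun l hl => by
      rw [Function.update_of_ne ((Finset.mem_Iio.1 hl).trans h).ne]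
    have h2 := sum_Iio_update n m k j i h u (u j)
    rw [Function.update_eq_self] at h2
    rw [Equiv.swap_comm, koszulSign_swap n m k j i h, hs, h1, h2]
    simp only [Function.comp_apply, Equiv.swap_apply_left, Equiv.swap_apply_right]
    generalize ∑ l ∈ Finset.Ioo j i, parity n m (u l) = M
    generalize ∑ l ∈ Finset.Iio j, parity n m (u l) = S
    rcases hp (u i) with e | e <;> rcases hp (u j) with e' | e' <;> rw [e, e'] <;>
      refine neg_one_pow_congr ?_ <;> simp only [Nat.even_iff] <;> omega

/-- If `σ` is a product of transpositions `s_1 ⋯ s_l`, then `P_σ = P_{s_1} ⋯ P_{s_l}`. -/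
theorem gradedPerm_list_prod (n m k : ℕ) (l : List (Fin k × Fin k))
    (hl : ∀ x ∈ l, x.1 ≠ x.2) :
    gradedPerm n m k (l.map fun x => Equiv.swap x.1 x.2).prod =
      (l.map fun x => gradedSwap n m k x.1 x.2).prod := by
  induction l with
  | nil => simpa using gradedPerm_one n m k
  | cons x l ih =>
    rw [List.map_cons, List.map_cons, List.prod_cons, List.prod_cons, gradedPerm_mul,
      gradedPerm_swap n m k _ _ (hl x (by simp)), ih fun y hy => hl y (by simp [hy])]

/-- The weight subspace `V[1]`: all vectors on which every `E_{aa}` acts as the identity. -/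
def weightOne (n m k : ℕ) : Submodule ℂ (TensorSpace n m k) where
  carrier := {v | ∀ a, total n m k a a v = v}
  add_mem' hv hw a := by rw [map_add, hv a, hw a]
  zero_mem' a := map_zero _
  smul_mem' c v hv a := by rw [map_smul, hv a]

/-- For `k = n + m`, the covectors `⟨Ω^i| = ∑_σ sgn(σ)^i ⟨e_1 ⊗ ⋯ ⊗ e_{n+m}| P_σ`, `i = 0, 1`,
where `⟨e_1 ⊗ ⋯ ⊗ e_{n+m}|` is the coordinate of `e_1 ⊗ ⋯ ⊗ e_{n+m}`. -/
def Omega (n m : ℕ) (i : Fin 2) : TensorSpace n m (n + m) →ₗ[ℂ] ℂ :=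
  ∑ σ : Equiv.Perm (Fin (n + m)), ((Equiv.Perm.sign σ : ℤ) : ℂ) ^ (i : ℕ) •
    (LinearMap.proj (fun j : Fin (n + m) => j) ∘ₗ gradedPerm n m (n + m) σ)

/-- The partial derivative `∂/∂z_i` of a function of `(z, λ)`. -/
def partialZ {k N : ℕ} {E : Type*} [NormedAddCommGroup E] [NormedSpace ℂ E] (i : Fin k)
    (F : (Fin k → ℂ) × (Fin N → ℂ) → E) (x : (Fin k → ℂ) × (Fin N → ℂ)) : E :=
  deriv (fun t => F (Function.update x.1 i t, x.2)) (x.1 i)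

/-- The partial derivative `∂/∂λ_a` of a function of `(z, λ)`. -/
def partialL {k N : ℕ} {E : Type*} [NormedAddCommGroup E] [NormedSpace ℂ E] (a : Fin N)
    (F : (Fin k → ℂ) × (Fin N → ℂ) → E) (x : (Fin k → ℂ) × (Fin N → ℂ)) : E :=
  deriv (fun t => F (x.1, Function.update x.2 a t)) (x.2 a)

/-- The points `(z, λ)` with pairwise distinct `z_i` and pairwise distinct `λ_a`. -/
def configSpace (k N : ℕ) : Set ((Fin k → ℂ) × (Fin N → ℂ)) :=
  {x | Function.Injective x.1 ∧ Function.Injective x.2}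

/-- `Ψ` satisfies the twisted Knizhnik–Zamolodchikov equations on `U`. -/
def SolvesKZ (n m k : ℕ) (κ : ℂ) (U : Set ((Fin k → ℂ) × (Fin (n + m) → ℂ)))
    (Ψ : (Fin k → ℂ) × (Fin (n + m) → ℂ) → TensorSpace n m k) : Prop :=
  ∀ x ∈ U, ∀ i : Fin k,
    κ • partialZ i Ψ x - ∑ c, x.2 c • unitAt n m k i c c (Ψ x) -
      ∑ j ∈ Finset.univ.erase i, (x.1 i - x.1 j)⁻¹ • gradedSwap n m k i j (Ψ x) = 0

/-- `Ψ` satisfies the Dynamical equations on `U`. -/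
def SolvesDynamical (n m k : ℕ) (κ : ℂ) (U : Set ((Fin k → ℂ) × (Fin (n + m) → ℂ)))
    (Ψ : (Fin k → ℂ) × (Fin (n + m) → ℂ) → TensorSpace n m k) : Prop :=
  ∀ x ∈ U, ∀ a : Fin (n + m),
    κ • partialL a Ψ x - ∑ j, x.1 j • unitAt n m k j a a (Ψ x) -
      ∑ b ∈ Finset.univ.erase a, ((-1 : ℂ) ^ parity n m b * (x.2 a - x.2 b)⁻¹) •
        (total n m k a b * total n m k b a - total n m k a a) (Ψ x) = 0

end

end SuperKZ

/-! Both systems have the shape `κ ∂_i G = D_i G + ∑_{j ≠ i} (z_i - z_j)⁻¹ P_ij G`, and the covector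
turns the operators `P_ij` into the scalar `s = (-1)^i`: `φ P_ij = s φ` and `φ D_i P_ij = s φ D_j`
on the values of `G`. With `R_i = ∑_{j ≠ i} (z_i - z_j)⁻¹` this gives `κ ∂_i φ(G) = φ(D_i G) + s R_i
φ(G)`. Differentiating once more and summing over `i`, the terms linear in `D` cancel by
antisymmetry. The three-term identity turns `∑ R_i²` into `∑ (z_i - z_j)⁻²`, while the derivatives
of the `R_i` contribute `-sκ` times the same sum. What remains is `∑ φ(D_i² G)`, a constant multiple
of `φ(G)`. This is `calogero_of_system`.

For the KZ equations the relations with `φ` express that `Ω^i` spans a one-dimensional character of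
the symmetric group (`Omega_gradedPerm`) and that graded swaps exchange the diagonal operators. For
the dynamical equations the point is `dynamical_basisVec`: on a word with distinct letters, the
operator attached to the letters `a`, `b` is the graded swap of the places they occupy. Hence on
`V[1]` the second system has the same shape, with `z` and `λ` exchanged. -/

namespace SuperKZ

/-! ### From first-order systems to the Calogero–Moser operator. -/

section Calogero

theorem sum_sum_erase_swap_antisymm {N : ℕ} (f : Fin N → Fin N → ℂ)
    (hf : ∀ i j, f j i = -f i j) : ∑ i, ∑ j ∈ Finset.univ.erase i, f i j = 0 := by
  have h0 : ∀ i, f i i = 0 := fun i => by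
    have := hf i i
    linear_combination this / 2
  have h1 : ∀ i, ∑ j ∈ Finset.univ.erase i, f i j = ∑ j, f i j := fun i => by
    rw [← Finset.add_sum_erase _ _ (Finset.mem_univ i), h0, zero_add]
  simp only [h1]
  have h2 : ∑ i, ∑ j, f i j = -∑ i, ∑ j, f i j := by
    conv_lhs => rw [Finset.sum_comm]
    simp only [← Finset.sum_neg_distrib, ← hf]
  linear_combination h2 / 2

/-- The three-term identity `∑_i (∑_{j≠i} 1/(z_i - z_j))² = ∑_{i≠j} 1/(z_i - z_j)²`. -/
theorem sum_sq_sum_inv_sub {N : ℕ} (z : Fin N → ℂ) (hz : Function.Injective z) :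
    ∑ i, (∑ j ∈ Finset.univ.erase i, (z i - z j)⁻¹) ^ 2 =
      ∑ i, ∑ j ∈ Finset.univ.erase i, ((z i - z j)⁻¹) ^ 2 := by
  -- These are the off-diagonal terms of the expanded square. The indices `j = i` and `k = i` need
  -- no exclusion, because `0⁻¹ = 0`.
  set g : Fin N → Fin N → Fin N → ℂ := fun i j k =>
    if j = k then 0 else (z i - z j)⁻¹ * (z i - z k)⁻¹ with hg
  have hg1 : ∀ i j k, g i j k + g j k i + g k i j = 0 := by
    intro i j k
    simp only [hg]
    by_cases h1 : j = k
    · subst h1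
      simp
    by_cases h2 : k = i
    · subst h2
      simp
    by_cases h3 : i = j
    · subst h3
      simp
    have e1 := sub_ne_zero.2 (hz.ne h1)
    have e2 := sub_ne_zero.2 (hz.ne h2)
    have e3 := sub_ne_zero.2 (hz.ne h3)
    -- With the differences oriented cyclically, the identity says that they add up to zero.
    rw [← neg_sub (z k) (z i), ← neg_sub (z i) (z j), ← neg_sub (z j) (z k)]
    simp only [h1, h2, h3, if_false]
    field_simp
    ring
  have hsum : ∑ i, ∑ j, ∑ k, g i j k = 0 := by
    have h1 : ∑ i, ∑ j, ∑ k, g j k i = ∑ i, ∑ j, ∑ k, g i j k := by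
      rw [Finset.sum_comm]
      exact Finset.sum_congr rfl fun _ _ => Finset.sum_comm
    have h2 : ∑ i, ∑ j, ∑ k, g k i j = ∑ i, ∑ j, ∑ k, g i j k := by
      refine (Finset.sum_congr rfl fun _ _ => Finset.sum_comm).trans ?_
      exact Finset.sum_comm
    have h3 : ∑ i, ∑ j, ∑ k, (g i j k + g j k i + g k i j) = 0 := by simp [hg1]
    simp only [Finset.sum_add_distrib, h1, h2] at h3
    linear_combination h3 / 3
  have hsq : ∀ i, (∑ j ∈ Finset.univ.erase i, (z i - z j)⁻¹) ^ 2 =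
      ∑ j ∈ Finset.univ.erase i, ((z i - z j)⁻¹) ^ 2 + ∑ j, ∑ k, g i j k := by
    intro i
    have e1 : ∑ j ∈ Finset.univ.erase i, (z i - z j)⁻¹ = ∑ j, (z i - z j)⁻¹ := by
      rw [← Finset.add_sum_erase _ _ (Finset.mem_univ i)]
      simp
    have e2 : ∑ j ∈ Finset.univ.erase i, ((z i - z j)⁻¹) ^ 2 = ∑ j, ((z i - z j)⁻¹) ^ 2 := by
      rw [← Finset.add_sum_erase _ _ (Finset.mem_univ i)]
      simp
    rw [e1, e2, sq, Finset.sum_mul_sum, ← Finset.sum_add_distrib]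
    refine Finset.sum_congr rfl fun j _ => ?_
    rw [← Finset.add_sum_erase _ _ (Finset.mem_univ j),
      ← Finset.add_sum_erase _ (g i j) (Finset.mem_univ j)]
    simp only [hg, if_true, zero_add, sq]
    congr 1
    refine Finset.sum_congr rfl fun k hk => ?_
    rw [if_neg (Finset.ne_of_mem_erase hk).symm]
  rw [Finset.sum_congr rfl fun i _ => hsq i, Finset.sum_add_distrib, hsum, add_zero]

/-- A covector that intertwines a system of Knizhnik–Zamolodchikov type with scalars produces
eigenfunctions of the Calogero–Moser operator. -/
theorem calogero_of_system {N : ℕ} {E : Type*} [NormedAddCommGroup E] [NormedSpace ℂ E]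
    [FiniteDimensional ℂ E] (κ s C : ℂ) (hs : s * s = 1)
    (S : Set (Fin N → ℂ)) (hS : IsOpen S) (hSinj : ∀ z ∈ S, Function.Injective z)
    (G : (Fin N → ℂ) → E) (hG : DifferentiableOn ℂ G S)
    (D : Fin N → Module.End ℂ E) (P : Fin N → Fin N → Module.End ℂ E)
    (hsys : ∀ z ∈ S, ∀ i, κ • deriv (fun t => G (Function.update z i t)) (z i) =
      D i (G z) + ∑ j ∈ Finset.univ.erase i, (z i - z j)⁻¹ • P i j (G z))
    (φ : E →ₗ[ℂ] ℂ) (hP : ∀ z ∈ S, ∀ i j, i ≠ j → φ (P i j (G z)) = s * φ (G z))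
    (hDP : ∀ z ∈ S, ∀ i j, i ≠ j → φ (D i (P i j (G z))) = s * φ (D j (G z)))
    (hDD : ∀ z ∈ S, ∑ i, φ (D i (D i (G z))) = C * φ (G z)) (z : Fin N → ℂ) (hz : z ∈ S) :
    κ ^ 2 * ∑ i, deriv (fun t => deriv (fun t' => φ (G (Function.update
          (Function.update z i t) i t'))) (Function.update z i t i)) (z i) +
        (∑ i, ∑ j ∈ Finset.univ.erase i, (s * κ - 1) / (z i - z j) ^ 2) * φ (G z) =
      C * φ (G z) := by
  have hline : ∀ z ∈ S, ∀ i, DifferentiableAt ℂ (fun t => G (Function.update z i t)) (z i) := by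
    intro z hz i
    have h1 : DifferentiableAt ℂ G (Function.update z i (z i)) := by
      rw [Function.update_eq_self]
      exact hG.differentiableAt (hS.mem_nhds hz)
    exact h1.comp (z i) (hasDerivAt_update z i (z i)).differentiableAt
  have hlin : ∀ (ψ : E →ₗ[ℂ] ℂ), ∀ z ∈ S, ∀ i,
      HasDerivAt (fun t => ψ (G (Function.update z i t)))
        (ψ (deriv (fun t => G (Function.update z i t)) (z i))) (z i) := fun ψ z hz i =>
    (LinearMap.toContinuousLinearMap ψ).hasFDerivAt.comp_hasDerivAt (z i)
      (hline z hz i).hasDerivAt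
  have hfirst : ∀ z ∈ S, ∀ i, κ * deriv (fun t => φ (G (Function.update z i t))) (z i) =
      φ (D i (G z)) + s * (∑ j ∈ Finset.univ.erase i, (z i - z j)⁻¹) * φ (G z) := by
    intro z hz i
    rw [(hlin φ z hz i).deriv, ← smul_eq_mul, ← map_smul, hsys z hz i, map_add, map_sum]
    congr 1
    rw [Finset.mul_sum, Finset.sum_mul]
    refine Finset.sum_congr rfl fun j hj => ?_
    rw [map_smul, hP z hz i j (Finset.ne_of_mem_erase hj).symm, smul_eq_mul]
    ring
  have hfirstD : ∀ z ∈ S, ∀ i, κ * φ (D i (deriv (fun t => G (Function.update z i t)) (z i))) =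
      φ (D i (D i (G z))) + s * ∑ j ∈ Finset.univ.erase i, (z i - z j)⁻¹ * φ (D j (G z)) := by
    intro z hz i
    rw [← smul_eq_mul, ← map_smul, ← map_smul, hsys z hz i, map_add, map_add, map_sum, map_sum]
    congr 1
    rw [Finset.mul_sum]
    refine Finset.sum_congr rfl fun j hj => ?_
    rw [map_smul, map_smul, hDP z hz i j (Finset.ne_of_mem_erase hj).symm, smul_eq_mul]
    ring
  have hsecond : ∀ i, κ ^ 2 * deriv (fun t => deriv (fun t' => φ (G (Function.update
        (Function.update z i t) i t'))) (Function.update z i t i)) (z i) =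
      φ (D i (D i (G z))) +
        s * (∑ j ∈ Finset.univ.erase i, (z i - z j)⁻¹ * (φ (D i (G z)) + φ (D j (G z)))) +
        ((∑ j ∈ Finset.univ.erase i, (z i - z j)⁻¹) ^ 2 -
          s * κ * ∑ j ∈ Finset.univ.erase i, ((z i - z j)⁻¹) ^ 2) * φ (G z) := by
    intro i
    -- The first-order equation may be differentiated because it holds near `z i` along the whole
    -- coordinate line, not only at `z`.
    have hev : ∀ᶠ t in nhds (z i), Function.update z i t ∈ S := by
      have hc : ContinuousAt (fun t => Function.update z i t) (z i) :=
        (hasDerivAt_update z i (z i)).continuousAt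
      refine hc.eventually_mem (hS.mem_nhds ?_)
      rwa [Function.update_eq_self]
    have hev' : (fun t => κ * deriv (fun t' => φ (G (Function.update
          (Function.update z i t) i t'))) (Function.update z i t i)) =ᶠ[nhds (z i)]
        fun t => φ (D i (G (Function.update z i t))) +
          s * (∑ j ∈ Finset.univ.erase i, (t - z j)⁻¹) * φ (G (Function.update z i t)) := by
      filter_upwards [hev] with t ht
      rw [hfirst _ ht i, Function.update_self]
      congr 3
      refine Finset.sum_congr rfl fun j hj => ?_
      rw [Function.update_of_ne (Finset.ne_of_mem_erase hj)]
    have hR : HasDerivAt (fun t => ∑ j ∈ Finset.univ.erase i, (t - z j)⁻¹)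
        (∑ j ∈ Finset.univ.erase i, -((z i - z j)⁻¹) ^ 2) (z i) := by
      refine HasDerivAt.fun_sum fun j hj => ?_
      have hne := sub_ne_zero.2 ((hSinj z hz).ne (Finset.ne_of_mem_erase hj).symm)
      refine (((hasDerivAt_id (z i)).sub_const (z j)).fun_inv hne).congr_deriv ?_
      simp [neg_div, inv_pow]
    have hder := ((hlin (φ ∘ₗ D i) z hz i).add
      ((hR.const_mul s).mul (hlin φ z hz i))).congr_of_eventuallyEq hev'
    have hd := hder.deriv
    rw [deriv_const_mul_field] at hd
    rw [sq, mul_assoc, hd]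
    simp only [LinearMap.comp_apply, Function.update_eq_self, Finset.sum_neg_distrib]
    have f1 := hfirst z hz i
    have f2 := hfirstD z hz i
    rw [(hlin φ z hz i).deriv] at f1
    simp only [mul_add, Finset.sum_add_distrib, ← Finset.sum_mul]
    -- The system is used twice: `f2` for the derivative of `φ (D i G)`, and `f1` for that of `φ G`
    -- in the product rule. The last term replaces `s²` by `1` in front of `R_i²`.
    linear_combination f2 + s * (∑ j ∈ Finset.univ.erase i, (z i - z j)⁻¹) * f1 +
      (∑ j ∈ Finset.univ.erase i, (z i - z j)⁻¹) ^ 2 * φ (G z) * hs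
  have hanti : ∑ i, ∑ j ∈ Finset.univ.erase i,
      (z i - z j)⁻¹ * (φ (D i (G z)) + φ (D j (G z))) = 0 :=
    sum_sum_erase_swap_antisymm _ fun i j => by
      rw [← neg_sub, inv_neg]
      ring
  have hC : ∑ i, ∑ j ∈ Finset.univ.erase i, (s * κ - 1) / (z i - z j) ^ 2 =
      (s * κ - 1) * ∑ i, ∑ j ∈ Finset.univ.erase i, ((z i - z j)⁻¹) ^ 2 := by
    simp only [Finset.mul_sum, div_eq_mul_inv, inv_pow]
  rw [Finset.mul_sum, Finset.sum_congr rfl fun i _ => hsecond i, hC]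
  simp only [Finset.sum_add_distrib, ← Finset.mul_sum, ← Finset.sum_mul, Finset.sum_sub_distrib]
  rw [hanti, sum_sq_sum_inv_sub z (hSinj z hz), hDD z hz]
  ring

end Calogero

/-! ### The covectors, the weight space and the dynamical operators. -/

section Operators

variable {n m k : ℕ}

theorem unitAt_diag_apply (i : Fin k) (c : Fin (n + m)) (v : TensorSpace n m k)
    (u : Fin k → Fin (n + m)) :
    unitAt n m k i c c v u = if u i = c then v u else 0 := by
  simp only [unitAt, LinearMap.coe_mk, AddHom.coe_mk]
  split_ifs with h
  · subst h
    rw [Function.update_eq_self, Even.neg_one_pow, one_mul]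
    exact (Even.add_self _).mul_right _
  · rfl

theorem unitAt_diag_mul_gradedPerm (σ : Equiv.Perm (Fin k)) (i : Fin k) (c : Fin (n + m)) :
    unitAt n m k (σ i) c c * gradedPerm n m k σ = gradedPerm n m k σ * unitAt n m k i c c := by
  refine LinearMap.ext fun v => funext fun u => ?_
  simp [unitAt_diag_apply, gradedPerm]

theorem total_diag_apply (c : Fin (n + m)) (v : TensorSpace n m k) (u : Fin k → Fin (n + m)) :
    total n m k c c v u = (Finset.univ.filter fun j => u j = c).card * v u := by
  simp [total, LinearMap.sum_apply, Finset.sum_apply, unitAt_diag_apply, Finset.sum_ite]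

/-- Right translation by `σ` permutes the summands of `Omega` and changes each coefficient by the
factor `sgn(σ)^i`. -/
theorem Omega_gradedPerm (i : Fin 2) (σ : Equiv.Perm (Fin (n + m)))
    (v : TensorSpace n m (n + m)) :
    Omega n m i (gradedPerm n m (n + m) σ v) =
      ((Equiv.Perm.sign σ : ℤ) : ℂ) ^ (i : ℕ) * Omega n m i v := by
  simp only [Omega, LinearMap.sum_apply, LinearMap.smul_apply, LinearMap.comp_apply, smul_eq_mul,
    Finset.mul_sum]
  refine Fintype.sum_equiv (Equiv.mulRight σ) _ _ fun τ => ?_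
  rw [Equiv.coe_mulRight, gradedPerm_mul, Module.End.mul_apply, ← mul_assoc, ← mul_pow]
  congr 2
  rw [Equiv.Perm.sign_mul]
  push_cast
  have : ((Equiv.Perm.sign σ : ℤ) : ℂ) * ((Equiv.Perm.sign σ : ℤ) : ℂ) = 1 := by
    rcases Int.units_eq_one_or (Equiv.Perm.sign σ) with h | h <;> simp [h]
  linear_combination -((Equiv.Perm.sign τ : ℤ) : ℂ) * this

theorem Omega_gradedSwap (i : Fin 2) {a b : Fin (n + m)} (hab : a ≠ b)
    (v : TensorSpace n m (n + m)) :
    Omega n m i (gradedSwap n m (n + m) a b v) = (-1) ^ (i : ℕ) * Omega n m i v := by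
  rw [← gradedPerm_swap _ _ _ _ _ hab, Omega_gradedPerm, Equiv.Perm.sign_swap hab]
  simp

/-- On a word, `E_cc` is multiplication by the number of occurrences of `c`, so weight one forbids
repeated letters. -/
theorem injective_of_mem_weightOne {v : TensorSpace n m k} (hv : v ∈ weightOne n m k)
    {u : Fin k → Fin (n + m)} (hu : v u ≠ 0) : Function.Injective u := by
  intro x y hxy
  have h := congrFun (hv (u y)) u
  rw [total_diag_apply, mul_eq_right₀ hu, Nat.cast_eq_one, Finset.card_eq_one] at h
  obtain ⟨c, hc⟩ := h
  have hx : x ∈ Finset.univ.filter fun j => u j = u y := by simp [hxy]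
  have hy : y ∈ Finset.univ.filter fun j => u j = u y := by simp
  rw [hc, Finset.mem_singleton] at hx hy
  rw [hx, hy]

/-- Two linear maps agree on `V[1]` if they agree on the words in which each letter occurs once. -/
theorem eq_of_mem_weightOne {F : Type*} [AddCommGroup F] [Module ℂ F]
    {f g : TensorSpace n m (n + m) →ₗ[ℂ] F}
    (h : ∀ w : Equiv.Perm (Fin (n + m)), f (basisVec n m (n + m) w) = g (basisVec n m (n + m) w))
    {v : TensorSpace n m (n + m)} (hv : v ∈ weightOne n m (n + m)) : f v = g v := by
  have hsum : v = ∑ u, v u • basisVec n m (n + m) u := by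
    funext x
    simp [basisVec, Finset.sum_apply, Pi.single_apply]
  rw [hsum, map_sum, map_sum]
  refine Finset.sum_congr rfl fun u _ => ?_
  rw [map_smul, map_smul]
  by_cases hu : v u = 0
  · simp [hu]
  · have hbij := Finite.injective_iff_bijective.1 (injective_of_mem_weightOne hv hu)
    exact congrArg (v u • ·) (h (Equiv.ofBijective u hbij))

theorem unitAt_diag_basisVec (i : Fin k) (c : Fin (n + m)) (w : Fin k → Fin (n + m)) :
    unitAt n m k i c c (basisVec n m k w) = if w i = c then basisVec n m k w else 0 := by
  rw [unitAt_basisVec]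
  split_ifs with h
  · subst h
    rw [Function.update_eq_self, Even.neg_one_pow, one_smul]
    exact (Even.add_self _).mul_right _
  · rfl

/-- Both factors carry the same sign, since changing the letter at `i` leaves the earlier places
alone. This makes the same-place part of `E_ab E_ba` cancel against `E_aa`. -/
theorem unitAt_mul_unitAt_self (i : Fin k) (a b : Fin (n + m)) :
    unitAt n m k i a b * unitAt n m k i b a = unitAt n m k i a a := by
  refine LinearMap.ext fun v => funext fun u => ?_
  have hs : ∑ l ∈ Finset.Iio i, parity n m (Function.update u i b l) =
      ∑ l ∈ Finset.Iio i, parity n m (u l) := Finset.sum_congr rfl fun l hl => by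
    rw [Function.update_of_ne (Finset.mem_Iio.1 hl).ne]
  rw [unitAt_diag_apply]
  simp only [Module.End.mul_apply, unitAt, LinearMap.coe_mk, AddHom.coe_mk, Function.update_self,
    if_true, Function.update_idem, hs]
  split_ifs with h
  · subst h
    rw [Function.update_eq_self, ← mul_assoc, ← pow_add, Even.neg_one_pow, one_mul]
    rw [add_comm (parity n m b)]
    exact Even.add_self _
  · rfl

/-- On a word `w` in which each letter occurs once, the dynamical operator attached to the letters
`a ≠ b` acts as the graded permutation of the places of `b` and `a`. -/
theorem dynamical_basisVec (w : Equiv.Perm (Fin (n + m))) {a b : Fin (n + m)} (hab : a ≠ b) :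
    (-1 : ℂ) ^ parity n m b • (total n m (n + m) a b * total n m (n + m) b a -
        total n m (n + m) a a) (basisVec n m (n + m) w) =
      gradedSwap n m (n + m) (w.symm b) (w.symm a) (basisVec n m (n + m) w) := by
  obtain ⟨i, rfl⟩ := w.surjective a
  obtain ⟨j, rfl⟩ := w.surjective b
  have hij : i ≠ j := fun h => hab (congrArg w h)
  simp only [Equiv.symm_apply_apply]
  have hT : ∀ c, total n m (n + m) c (w i) (basisVec n m (n + m) w) =
      unitAt n m (n + m) i c (w i) (basisVec n m (n + m) w) := fun c => by
    rw [total, LinearMap.sum_apply, Finset.sum_eq_single i]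
    · intro l _ hl
      rw [unitAt_basisVec, if_neg (w.injective.ne hl)]
    · simp
  -- After `E_ba` the letter `b` stands at both places `i` and `j`, so `E_ab` has two terms. The one
  -- at `i` restores `w` and is removed by `E_aa`; the one at `j` is the only term of the graded
  -- swap that does not kill `w`.
  have hTT : total n m (n + m) (w i) (w j)
        (unitAt n m (n + m) i (w j) (w i) (basisVec n m (n + m) w)) =
      unitAt n m (n + m) i (w i) (w j)
          (unitAt n m (n + m) i (w j) (w i) (basisVec n m (n + m) w)) +
        unitAt n m (n + m) j (w i) (w j)
          (unitAt n m (n + m) i (w j) (w i) (basisVec n m (n + m) w)) := by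
    rw [total, LinearMap.sum_apply]
    refine Finset.sum_eq_add i j hij ?_ (by simp) (by simp)
    rintro l - ⟨hl1, hl2⟩
    rw [unitAt_basisVec n m (n + m) i, if_pos rfl, map_smul, unitAt_basisVec,
      Function.update_of_ne hl1, if_neg (w.injective.ne hl2), smul_zero]
  have hS : gradedSwap n m (n + m) j i (basisVec n m (n + m) w) =
      (-1 : ℂ) ^ parity n m (w j) • unitAt n m (n + m) j (w i) (w j)
        (unitAt n m (n + m) i (w j) (w i) (basisVec n m (n + m) w)) := by
    simp only [gradedSwap, LinearMap.sum_apply, LinearMap.smul_apply, Module.End.mul_apply]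
    rw [Finset.sum_eq_single (w i), Finset.sum_eq_single (w j)]
    · intro b _ hb
      rw [unitAt_basisVec n m (n + m) i, if_pos rfl, map_smul, unitAt_basisVec,
        Function.update_of_ne hij.symm, if_neg hb.symm, smul_zero, smul_zero]
    · simp
    · intro a _ ha
      refine Finset.sum_eq_zero fun b _ => ?_
      rw [unitAt_basisVec n m (n + m) i, if_neg ha.symm, map_zero, smul_zero]
    · simp
  rw [hS, LinearMap.sub_apply, Module.End.mul_apply, hT, hT, hTT, ← Module.End.mul_apply
    (unitAt n m (n + m) i (w i) (w j)), unitAt_mul_unitAt_self, add_sub_cancel_left]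

theorem sum_smul_unitAt_diag_basisVec (z : Fin (n + m) → ℂ) (w : Equiv.Perm (Fin (n + m)))
    (a : Fin (n + m)) :
    ∑ j, z j • unitAt n m (n + m) j a a (basisVec n m (n + m) w) =
      z (w.symm a) • basisVec n m (n + m) w := by
  rw [Finset.sum_eq_single (w.symm a)]
  · simp [unitAt_diag_basisVec]
  · intro j _ hj
    rw [unitAt_diag_basisVec, if_neg fun h => hj (by simp [← h]), smul_zero]
  · simp

theorem sum_smul_unitAt_diag_gradedPerm (z : Fin (n + m) → ℂ) (σ w : Equiv.Perm (Fin (n + m)))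
    (a : Fin (n + m)) :
    ∑ j, z j • unitAt n m (n + m) j a a
        (gradedPerm n m (n + m) σ (basisVec n m (n + m) w)) =
      z (σ (w.symm a)) • gradedPerm n m (n + m) σ (basisVec n m (n + m) w) := by
  -- Up to a sign, `P_σ` sends the word `w` to the word `w * σ⁻¹`.
  have h := sum_smul_unitAt_diag_basisVec z (w * σ⁻¹) a
  have h' : (w * σ⁻¹).symm a = σ (w.symm a) := by
    rw [Equiv.symm_apply_eq]
    simp
  rw [h'] at h
  rw [gradedPerm_basisVec, smul_comm (z _)]
  simp only [map_smul, smul_comm (z _) (koszulSign _ _ _ _ _), ← Finset.smul_sum]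
  exact congrArg _ h

theorem Omega_dynamical (i : Fin 2) {a b : Fin (n + m)} (hab : a ≠ b)
    {v : TensorSpace n m (n + m)} (hv : v ∈ weightOne n m (n + m)) :
    Omega n m i (((-1 : ℂ) ^ parity n m b • (total n m (n + m) a b * total n m (n + m) b a -
        total n m (n + m) a a)) v) = (-1) ^ (i : ℕ) * Omega n m i v := by
  refine eq_of_mem_weightOne (f := Omega n m i ∘ₗ _) (g := (-1 : ℂ) ^ (i : ℕ) • Omega n m i)
    (fun w => ?_) hv
  rw [LinearMap.comp_apply, LinearMap.smul_apply _ (_ - _), dynamical_basisVec w hab,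
    Omega_gradedSwap i (w.symm.injective.ne hab.symm)]
  rfl

/-- After the swap the letter `a` sits where `b` was, so the diagonal operator of `a` reads off the
coordinate `z` at the old place of `b`. -/
theorem Omega_diag_dynamical (i : Fin 2) (z : Fin (n + m) → ℂ) {a b : Fin (n + m)} (hab : a ≠ b)
    {v : TensorSpace n m (n + m)} (hv : v ∈ weightOne n m (n + m)) :
    Omega n m i ((∑ j, z j • unitAt n m (n + m) j a a)
        (((-1 : ℂ) ^ parity n m b • (total n m (n + m) a b * total n m (n + m) b a -
          total n m (n + m) a a)) v)) =
      (-1) ^ (i : ℕ) * Omega n m i ((∑ j, z j • unitAt n m (n + m) j b b) v) := by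
  refine eq_of_mem_weightOne (f := Omega n m i ∘ₗ
      (_ : Module.End ℂ (TensorSpace n m (n + m))) ∘ₗ _) (g := (-1 : ℂ) ^ (i : ℕ) • (Omega n m i ∘ₗ _)) (fun w => ?_) hv
  have hne := w.symm.injective.ne hab.symm
  rw [LinearMap.comp_apply, LinearMap.comp_apply, LinearMap.smul_apply _ (_ - _),
    dynamical_basisVec w hab, LinearMap.smul_apply, LinearMap.comp_apply]
  simp only [LinearMap.sum_apply, LinearMap.smul_apply]
  rw [sum_smul_unitAt_diag_basisVec, ← gradedPerm_swap _ _ _ _ _ hne,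
    sum_smul_unitAt_diag_gradedPerm, Equiv.swap_apply_right, map_smul, map_smul,
    gradedPerm_swap _ _ _ _ _ hne, Omega_gradedSwap i hne]
  simp only [smul_eq_mul]
  ring

/-- Conjugation by the graded swap moves the even operators `e_cc` from place `j` to place `i`
without a sign; no weight condition enters. -/
theorem diag_mul_gradedSwap (l : Fin (n + m) → ℂ) {i j : Fin k} (hij : i ≠ j) :
    (∑ c, l c • unitAt n m k i c c) * gradedSwap n m k i j =
      gradedSwap n m k i j * ∑ c, l c • unitAt n m k j c c := by
  rw [← gradedPerm_swap _ _ _ _ _ hij, Finset.sum_mul, Finset.mul_sum]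
  refine Finset.sum_congr rfl fun c _ => ?_
  have h := unitAt_diag_mul_gradedPerm (n := n) (m := m) (Equiv.swap i j) j c
  rw [Equiv.swap_apply_right] at h
  rw [smul_mul_assoc, mul_smul_comm, h]

/-- A word with distinct letters is a common eigenvector with eigenvalues `l (w i)`, and `w` runs
through every letter exactly once. -/
theorem sum_diag_sq_of_mem_weightOne (l : Fin (n + m) → ℂ) {v : TensorSpace n m (n + m)}
    (hv : v ∈ weightOne n m (n + m)) :
    ∑ i, (∑ c, l c • unitAt n m (n + m) i c c) ((∑ c, l c • unitAt n m (n + m) i c c) v) =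
      (∑ c, l c ^ 2) • v := by
  -- An opaque name keeps `simp` from expanding the inner sum.
  obtain ⟨A, hA⟩ : ∃ A : Fin (n + m) → Module.End ℂ (TensorSpace n m (n + m)),
      ∀ i, A i = ∑ c, l c • unitAt n m (n + m) i c c := ⟨_, fun _ => rfl⟩
  simp only [← hA]
  have h := eq_of_mem_weightOne (f := ∑ i, A i * A i)
    (g := (∑ c, l c ^ 2) • LinearMap.id) (fun w => ?_) hv
  · simpa using h
  · have hw : ∀ i, A i (basisVec n m (n + m) w) =
        l (w i) • basisVec n m (n + m) w := fun i => by
      simp [hA, LinearMap.sum_apply, unitAt_diag_basisVec]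
    simp only [LinearMap.sum_apply, Module.End.mul_apply, LinearMap.smul_apply,
      LinearMap.id_apply, hw, map_smul, smul_smul, ← Finset.sum_smul]
    rw [← Equiv.sum_comp w fun c => l c ^ 2]
    simp only [sq]

theorem sum_total_diag_sq_of_mem_weightOne (z : Fin (n + m) → ℂ) {v : TensorSpace n m (n + m)}
    (hv : v ∈ weightOne n m (n + m)) :
    ∑ a, (∑ j, z j • unitAt n m (n + m) j a a) ((∑ j, z j • unitAt n m (n + m) j a a) v) =
      (∑ j, z j ^ 2) • v := by
  obtain ⟨A, hA⟩ : ∃ A : Fin (n + m) → Module.End ℂ (TensorSpace n m (n + m)),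
      ∀ a, A a = ∑ j, z j • unitAt n m (n + m) j a a := ⟨_, fun _ => rfl⟩
  simp only [← hA]
  have h := eq_of_mem_weightOne (f := ∑ a, A a * A a)
    (g := (∑ j, z j ^ 2) • LinearMap.id) (fun w => ?_) hv
  · simpa using h
  · have hw : ∀ a, A a (basisVec n m (n + m) w) =
        z (w.symm a) • basisVec n m (n + m) w := fun a => by
      simpa [hA] using sum_smul_unitAt_diag_basisVec z w a
    simp only [LinearMap.sum_apply, Module.End.mul_apply, LinearMap.smul_apply,
      LinearMap.id_apply, hw, map_smul, smul_smul, ← Finset.sum_smul]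
    rw [← Equiv.sum_comp w.symm fun c => z c ^ 2]
    simp only [sq]

end Operators

end SuperKZ

/-! ### The two Calogero–Moser equations, on the slices of `U` with `λ` or `z` fixed. -/

theorem theorem3 (n m : ℕ) (κ : ℂ)
    (U : Set ((Fin (n + m) → ℂ) × (Fin (n + m) → ℂ))) (hU : IsOpen U)
    (hUc : U ⊆ SuperKZ.configSpace (n + m) (n + m))
    (Ψ : (Fin (n + m) → ℂ) × (Fin (n + m) → ℂ) → SuperKZ.TensorSpace n m (n + m))
    (hΨ : DifferentiableOn ℂ Ψ U)
    (hKZ : SuperKZ.SolvesKZ n m (n + m) κ U Ψ)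
    (hDyn : SuperKZ.SolvesDynamical n m (n + m) κ U Ψ)
    (hV : ∀ x ∈ U, Ψ x ∈ SuperKZ.weightOne n m (n + m)) (i : Fin 2) :
    ∀ x ∈ U,
      (κ ^ 2 * ∑ a, SuperKZ.partialZ a (SuperKZ.partialZ a fun y => SuperKZ.Omega n m i (Ψ y)) x +
          (∑ a, ∑ b ∈ Finset.univ.erase a,
            ((-1) ^ (i : ℕ) * κ - 1) / (x.1 a - x.1 b) ^ 2) * SuperKZ.Omega n m i (Ψ x) =
        (∑ a, x.2 a ^ 2) * SuperKZ.Omega n m i (Ψ x)) ∧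
      (κ ^ 2 * ∑ a, SuperKZ.partialL a (SuperKZ.partialL a fun y => SuperKZ.Omega n m i (Ψ y)) x +
          (∑ a, ∑ b ∈ Finset.univ.erase a,
            ((-1) ^ (i : ℕ) * κ - 1) / (x.2 a - x.2 b) ^ 2) * SuperKZ.Omega n m i (Ψ x) =
        (∑ a, x.1 a ^ 2) * SuperKZ.Omega n m i (Ψ x)) := by
  intro x hx
  have hs : ((-1 : ℂ) ^ (i : ℕ)) * (-1) ^ (i : ℕ) = 1 := by
    rw [← mul_pow]
    simp
  constructor
  · refine SuperKZ.calogero_of_system κ ((-1) ^ (i : ℕ)) (∑ a, x.2 a ^ 2) hs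
      ((fun z => (z, x.2)) ⁻¹' U) (hU.preimage (by fun_prop)) (fun z hz => (hUc hz).1)
      (fun z => Ψ (z, x.2)) (hΨ.comp (by fun_prop) fun z hz => hz)
      (fun j => ∑ c, x.2 c • SuperKZ.unitAt n m (n + m) j c c)
      (fun j l => SuperKZ.gradedSwap n m (n + m) j l) ?_ (SuperKZ.Omega n m i) ?_ ?_ ?_ x.1 hx
    · intro z hz j
      have h := hKZ (z, x.2) hz j
      rw [sub_sub, sub_eq_zero] at h
      simpa [SuperKZ.partialZ] using h
    · intro z _ j l hjl
      exact SuperKZ.Omega_gradedSwap i hjl _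
    · intro z _ j l hjl
      rw [← Module.End.mul_apply, SuperKZ.diag_mul_gradedSwap _ hjl, Module.End.mul_apply,
        SuperKZ.Omega_gradedSwap i hjl]
    · intro z hz
      rw [← map_sum, SuperKZ.sum_diag_sq_of_mem_weightOne _ (hV _ hz), map_smul, smul_eq_mul]
  · refine SuperKZ.calogero_of_system κ ((-1) ^ (i : ℕ)) (∑ a, x.1 a ^ 2) hs
      ((fun l => (x.1, l)) ⁻¹' U) (hU.preimage (by fun_prop)) (fun l hl => (hUc hl).2)
      (fun l => Ψ (x.1, l)) (hΨ.comp (by fun_prop) fun l hl => hl)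
      (fun a => ∑ j, x.1 j • SuperKZ.unitAt n m (n + m) j a a)
      (fun a b => (-1 : ℂ) ^ SuperKZ.parity n m b • (SuperKZ.total n m (n + m) a b *
        SuperKZ.total n m (n + m) b a - SuperKZ.total n m (n + m) a a)) ?_
      (SuperKZ.Omega n m i) ?_ ?_ ?_ x.2 hx
    · intro l hl a
      have h := hDyn (x.1, l) hl a
      rw [sub_sub, sub_eq_zero] at h
      simpa [SuperKZ.partialL, mul_smul, smul_comm ((-1 : ℂ) ^ _)] using h
    · intro l hl a b hab
      exact SuperKZ.Omega_dynamical i hab (hV _ hl)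
    · intro l hl a b hab
      exact SuperKZ.Omega_diag_dynamical i x.1 hab (hV _ hl)
    · intro l hl
      rw [← map_sum, SuperKZ.sum_total_diag_sq_of_mem_weightOne _ (hV _ hl), map_smul, smul_eq_mul]
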